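/- Let $p_n$ denote the $n$-th prime ($p_1=2$), and let $P_1=\{p_n : n\ge 1,\ n \text{ not prime}\}$ (so $n$ is $1$ or composite). Let $T_1$ be the set of all twin pairs $\{v,v+2\}$ of primes greater than $5$. Let $T_{1u}$ (the u-pairs) be the set of the pairs in $T_1$ with both elements in $P_1$, and let $T_{1b}=T_1\setminus T_{1u}$ (the b-pairs). For natural numbers $l\ge 13$, $s\ge 3$ with $s\le l$ put $$D(l,s)=\frac{d(l-s+1)+d(l-s+2)+\dots+d(l)}{s+2},$$ where $d(m)$ is the number of prime factors of $m$ counted with multiplicity, and let $T_{sr}$ (the strongly related twins) be the set of the pairs $\{v,v+2\}\in T_1$ with $D(v+2,3)=1$. Put $T_{(sr)u}=T_{sr}\cap T_{1u}$ and $T_{(sr)b}=T_{sr}\cap T_{1b}$. Then for each of the six classes $T=T_1,\ T_{1u},\ T_{1b},\ T_{sr},\ T_{(sr)u},\ T_{(sr)b}$, whether it is finite or infinite, the series of positive terms $$\sum_{\{v,v+2\}\in T}\left(\frac1v+\frac1{v+2}\right)$$ (where $v$ is the smaller element of the pair) is convergent; in particular, if $T$ is infinite and $v_1<v_2<\cdots$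 are the smaller elements of its pairs, then $\sum_{i=1}^\infty\left(\frac1{v_i}+\frac1{v_i+2}\right)$ converges. -/

import Mathlib

namespace TwinPairs

/-- The `n`-th prime `p_n` for `n ≥ 1`: `p_1 = 2`, `p_2 = 3`, `p_3 = 5`, ...
(`Nat.nth` counts from `0`; the value at `n = 0` is never used). -/
noncomputable def nthPrime (n : ℕ) : ℕ := Nat.nth Nat.Prime (n - 1)

/-- The set of origins of the principal Eratosthenes rays: the primes `p_n` whose
number `n ≥ 1` is not prime, that is, `n` is `1` or composite. -/
def origins : Set ℕ := {p | ∃ n : ℕ, 1 ≤ n ∧ ¬ n.Prime ∧ p = nthPrime n}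

/-- The collective divisibility coefficient
`D(l, s) = (d(l - s + 1) + ... + d(l)) / (s + 2)`, for `1 ≤ s ≤ l`. Here `d(m)` is the number of
prime factors of `m` counted with multiplicity: this is the `d` for which the twin pairs
with `D(v + 2, 3) = 1` are the pairs around `v + 1 = 2 * 3 * σ` with `σ` prime
(`{11, 13}, {17, 19}, {29, 31}, {41, 43}, {101, 103}, {137, 139}, ...`). -/
def collectiveDivisibility (l s : ℕ) : ℚ :=
  ((∑ m ∈ Finset.Icc (l + 1 - s) l, ArithmeticFunction.cardFactors m : ℕ) : ℚ) / ((s : ℚ) + 2)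

/-! Each class of twin pairs `{v, v + 2}` is given by the set of the smaller elements `v`. -/

/-- Twin pairs of primes greater than `5`. -/
def twins : Set ℕ := {v | 5 < v ∧ v.Prime ∧ (v + 2).Prime}

/-- The u-pairs: both elements are origins of principal rays. -/
def twinsU : Set ℕ := {v | v ∈ twins ∧ v ∈ origins ∧ v + 2 ∈ origins}

/-- The b-pairs: all the other twin pairs. -/
def twinsB : Set ℕ := twins \ twinsU

/-- The strongly related twins: `D(l, 3) = 1` for the triple `v, v + 1, v + 2 = l`. -/
def strongTwins : Set ℕ := {v | v ∈ twins ∧ collectiveDivisibility (v + 2) 3 = 1}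

/-- The strongly related u-pairs. -/
def strongTwinsU : Set ℕ := strongTwins ∩ twinsU

/-- The strongly related b-pairs. -/
def strongTwinsB : Set ℕ := strongTwins ∩ twinsB

end TwinPairs

/-!
The reciprocals of the `v` such that `v` and `v + h` are prime are summed over the blocks
`[a ^ m, a ^ (m + 1))`, so it is enough that `[0, N)` contains `O(N / (log N)²)` such `v`.
This is the upper bound of Selberg's `Λ²` sieve for the integers `n (n + h)`: if `d` is squarefree
and coprime to `h`, then by the Chinese remainder theorem a proportion `τ(d) / d` of them is
divisible by `d`, with an error of at most `τ(d)`. The main term of the sieve is `N / S`, where `S`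
is at least the sum of `τ(l) / l` over the squarefree `l ≤ R` coprime to `2h`. Expanding
`τ(l)` as the number of factorisations `l = a b` and removing common factors of `a` and `b` at the
cost of a factor `ζ(2)`, this sum dominates a multiple of the square of the sum of `1 / a` over
the squarefree `a ≤ √R` coprime to `2h`. Since every integer is a square times a squarefree one,
the latter sum dominates a multiple of `log R`.
-/

open Finset ArithmeticFunction
open scoped ArithmeticFunction.Moebius

namespace Selberg

open BoundingSieve

theorem sum_moebius_divisors_filter_dvd {m : ℕ} (hm : Squarefree m) (l : ℕ) :
    ∑ d ∈ m.divisors with l ∣ d, μ d = if l = m then μ l else 0 := by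
  by_cases hlm : l ∣ m
  · obtain ⟨k, rfl⟩ := hlm
    obtain ⟨hl, hk⟩ : l ≠ 0 ∧ k ≠ 0 := mul_ne_zero_iff.1 hm.ne_zero
    have hcop : l.Coprime k := Nat.coprime_of_squarefree_mul hm
    have hmultiples : {d ∈ (l * k).divisors | l ∣ d} = k.divisors.image (l * ·) := by
      ext d
      simp only [mem_filter, Nat.mem_divisors, mem_image]
      constructor
      · rintro ⟨⟨hd, -⟩, e, rfl⟩
        exact ⟨e, ⟨Nat.dvd_of_mul_dvd_mul_left (Nat.pos_of_ne_zero hl) hd, hk⟩, rfl⟩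
      · rintro ⟨e, ⟨he, -⟩, rfl⟩
        exact ⟨⟨mul_dvd_mul_left l he, hm.ne_zero⟩, dvd_mul_right l e⟩
    calc ∑ d ∈ (l * k).divisors with l ∣ d, μ d
        = ∑ e ∈ k.divisors, μ (l * e) := by
          rw [hmultiples, sum_image (mul_right_injective₀ hl).injOn]
      _ = μ l * ∑ e ∈ k.divisors, μ e := by
          rw [mul_sum]
          exact sum_congr rfl fun e he => isMultiplicative_moebius.map_mul_of_coprime
            (hcop.coprime_dvd_right (Nat.dvd_of_mem_divisors he))
      _ = if l = l * k then μ l else 0 := by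
          rw [← coe_zeta_mul_apply, coe_zeta_mul_moebius, one_apply, mul_ite, mul_one, mul_zero]
          simp only [left_eq_mul₀ hl]
  · rw [if_neg (by rintro rfl; exact hlm dvd_rfl)]
    exact sum_eq_zero fun d hd => absurd
      ((mem_filter.1 hd).2.trans (Nat.dvd_of_mem_divisors (mem_filter.1 hd).1)) hlm

section LambdaSquared

variable {s : BoundingSieve} {w : ℕ → ℝ}

theorem abs_lambdaSquared_le {d n : ℕ} (hn : n ≠ 0) (hd : d ∣ n) :
    |lambdaSquared w d| ≤ ∑ d₁ ∈ n.divisors, ∑ d₂ ∈ n.divisors,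
      if d = d₁.lcm d₂ then |w d₁| * |w d₂| else 0 := by
  have hsub : d.divisors ⊆ n.divisors := Nat.divisors_subset_of_dvd hn hd
  have hterm_nonneg (d₁ d₂ : ℕ) : 0 ≤ if d = d₁.lcm d₂ then |w d₁| * |w d₂| else 0 := by
    split_ifs <;> positivity
  calc |lambdaSquared w d|
      ≤ ∑ d₁ ∈ d.divisors, ∑ d₂ ∈ d.divisors,
          |if d = d₁.lcm d₂ then w d₁ * w d₂ else 0| :=
        (abs_sum_le_sum_abs _ _).trans (sum_le_sum fun _ _ => abs_sum_le_sum_abs _ _)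
    _ = ∑ d₁ ∈ d.divisors, ∑ d₂ ∈ d.divisors, if d = d₁.lcm d₂ then |w d₁| * |w d₂| else 0 := by
        simp only [apply_ite abs, abs_mul, abs_zero]
    _ ≤ ∑ d₁ ∈ d.divisors, ∑ d₂ ∈ n.divisors, if d = d₁.lcm d₂ then |w d₁| * |w d₂| else 0 :=
        sum_le_sum fun _ _ => sum_le_sum_of_subset_of_nonneg hsub fun _ _ _ => hterm_nonneg _ _
    _ ≤ _ := sum_le_sum_of_subset_of_nonneg hsub fun _ _ _ => sum_nonneg fun _ _ =>
        hterm_nonneg _ _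

theorem errSum_lambdaSquared_le :
    s.errSum (lambdaSquared w) ≤ ∑ d₁ ∈ s.prodPrimes.divisors, ∑ d₂ ∈ s.prodPrimes.divisors,
      |w d₁| * |w d₂| * |s.rem (d₁.lcm d₂)| := by
  have hP : s.prodPrimes ≠ 0 := prodPrimes_ne_zero
  calc s.errSum (lambdaSquared w)
      ≤ ∑ d ∈ s.prodPrimes.divisors, (∑ d₁ ∈ s.prodPrimes.divisors, ∑ d₂ ∈ s.prodPrimes.divisors,
          if d = d₁.lcm d₂ then |w d₁| * |w d₂| else 0) * |s.rem d| :=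
        sum_le_sum fun d hd => mul_le_mul_of_nonneg_right
          (abs_lambdaSquared_le hP (Nat.dvd_of_mem_divisors hd)) (abs_nonneg _)
    _ = ∑ d₁ ∈ s.prodPrimes.divisors, ∑ d₂ ∈ s.prodPrimes.divisors, ∑ d ∈ s.prodPrimes.divisors,
          if d = d₁.lcm d₂ then |w d₁| * |w d₂| * |s.rem d| else 0 := by
        simp_rw [sum_mul, ite_mul, zero_mul]
        rw [sum_comm]
        exact sum_congr rfl fun _ _ => sum_comm
    _ = _ := sum_congr rfl fun d₁ h₁ => sum_congr rfl fun d₂ h₂ => by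
        rw [sum_ite_eq', if_pos (Nat.mem_divisors.2 ⟨Nat.lcm_dvd (Nat.dvd_of_mem_divisors h₁)
          (Nat.dvd_of_mem_divisors h₂), hP⟩)]

theorem errSum_lambdaSquared_le_sq (hrem : ∀ d, d ∣ s.prodPrimes → |s.rem d| ≤ d) :
    s.errSum (lambdaSquared w) ≤ (∑ d ∈ s.prodPrimes.divisors, |w d| * d) ^ 2 := by
  rw [sq, sum_mul_sum]
  refine errSum_lambdaSquared_le.trans (sum_le_sum fun d₁ h₁ => sum_le_sum fun d₂ h₂ => ?_)
  have hlcm_le : (d₁.lcm d₂ : ℝ) ≤ d₁ * d₂ := by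
    exact_mod_cast Nat.le_of_dvd
      (Nat.mul_pos (Nat.pos_of_mem_divisors h₁) (Nat.pos_of_mem_divisors h₂)) (Nat.lcm_dvd_mul _ _)
  have hrem_le : |s.rem (d₁.lcm d₂)| ≤ d₁ * d₂ :=
    (hrem _ (Nat.lcm_dvd (Nat.dvd_of_mem_divisors h₁) (Nat.dvd_of_mem_divisors h₂))).trans hlcm_le
  calc |w d₁| * |w d₂| * |s.rem (d₁.lcm d₂)| ≤ |w d₁| * |w d₂| * (d₁ * d₂) := by gcongr
    _ = |w d₁| * d₁ * (|w d₂| * d₂) := by ring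

end LambdaSquared

variable (s : BoundingSieve) (R : ℕ)

/-- The divisors of `s.prodPrimes` that are at most `R`: the set on which the Selberg weights of
level `R` live. In the usual notation with a sieve level `D`, this `R` is `√D`. -/
def support : Finset ℕ := {d ∈ s.prodPrimes.divisors | d ≤ R}

/-- The sum `S(R) = ∑ g(l)` of the Selberg terms over the divisors `l ≤ R` of `s.prodPrimes`;
its inverse is the minimum of the main term of the `Λ²` sieve. -/
noncomputable def mass : ℝ := ∑ l ∈ support s R, s.selbergTerms l

/-- The optimal weights of the `Λ²` sieve of level `R`. They vanish off `support s R`, because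
the inner sum is then empty. -/
noncomputable def weight (d : ℕ) : ℝ :=
  μ d * (s.nu d)⁻¹ * (∑ l ∈ support s R with d ∣ l, s.selbergTerms l) / mass s R

variable {s R}

theorem mem_support {d : ℕ} : d ∈ support s R ↔ d ∣ s.prodPrimes ∧ d ≤ R := by
  simp only [support, mem_filter, Nat.mem_divisors, ne_eq, prodPrimes_ne_zero, not_false_eq_true,
    and_true]

theorem selbergTerms_nonneg {l : ℕ} (hl : l ∈ support s R) : 0 ≤ s.selbergTerms l :=
  (selbergTerms_pos (mem_support.1 hl).1).le

theorem mass_pos (hR : R ≠ 0) : 0 < mass s R :=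
  sum_pos' (fun _ hl => selbergTerms_nonneg hl)
    ⟨1, mem_support.2 ⟨one_dvd _, Nat.one_le_iff_ne_zero.2 hR⟩, selbergTerms_pos (one_dvd _)⟩

theorem nu_le_selbergTerms {l : ℕ} (hl : l ∣ s.prodPrimes) : s.nu l ≤ s.selbergTerms l := by
  rw [selbergTerms_apply]
  refine le_mul_of_one_le_right (nu_pos_of_dvd_prodPrimes hl).le (one_le_prod fun p hp => ?_)
  have hp_prime := Nat.prime_of_mem_primeFactors hp
  have hp_dvd := (Nat.dvd_of_mem_primeFactors hp).trans hl
  exact (one_le_inv₀ (sub_pos.2 (s.nu_lt_one_of_prime p hp_prime hp_dvd))).2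
    (sub_le_self _ (s.nu_pos_of_prime p hp_prime hp_dvd).le)

theorem weight_one (hR : R ≠ 0) : weight s R 1 = 1 := by
  have hsum : ∑ l ∈ support s R with 1 ∣ l, s.selbergTerms l = mass s R := by
    simp only [one_dvd, filter_true, mass]
  rw [weight, hsum, moebius_apply_one, s.nu_mult.map_one, Int.cast_one, inv_one, mul_one, one_mul,
    div_self (mass_pos hR).ne']

theorem weight_eq_zero_of_lt {d : ℕ} (hd : R < d) : weight s R d = 0 := by
  rw [weight, sum_eq_zero, mul_zero, zero_div]
  intro l hl
  obtain ⟨⟨hlP, hlR⟩, hdl⟩ := (mem_filter.1 hl).imp_left mem_support.1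
  have hl0 : 0 < l := Nat.pos_of_dvd_of_pos hlP (Nat.pos_of_ne_zero prodPrimes_ne_zero)
  exact absurd ((Nat.le_of_dvd hl0 hdl).trans hlR) hd.not_ge

theorem abs_weight_le {d : ℕ} (hd : d ∣ s.prodPrimes) : |weight s R d| ≤ (s.nu d)⁻¹ := by
  have hnu : 0 < (s.nu d)⁻¹ := inv_pos.2 (nu_pos_of_dvd_prodPrimes hd)
  have hmu : |(μ d : ℝ)| ≤ 1 := by exact_mod_cast abs_moebius_le_one (n := d)
  have hsum_nonneg : 0 ≤ ∑ l ∈ support s R with d ∣ l, s.selbergTerms l :=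
    sum_nonneg fun l hl => selbergTerms_nonneg (mem_filter.1 hl).1
  have hsum_le : ∑ l ∈ support s R with d ∣ l, s.selbergTerms l ≤ mass s R :=
    sum_le_sum_of_subset_of_nonneg (filter_subset _ _) fun l hl _ => selbergTerms_nonneg hl
  have hmass : 0 ≤ mass s R := hsum_nonneg.trans hsum_le
  rw [weight, mul_div_assoc, abs_mul, abs_mul, abs_of_pos hnu,
    abs_of_nonneg (div_nonneg hsum_nonneg hmass)]
  calc _ ≤ 1 * (s.nu d)⁻¹ * 1 := by
        gcongr
        exact div_le_one_of_le₀ hsum_le hmass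
    _ = (s.nu d)⁻¹ := by ring

theorem sum_dvd_nu_mul_weight {l : ℕ} (hl : l ∣ s.prodPrimes) :
    (∑ d ∈ s.prodPrimes.divisors, if l ∣ d then s.nu d * weight s R d else 0) =
      if l ≤ R then μ l * (s.selbergTerms l / mass s R) else 0 := by
  calc (∑ d ∈ s.prodPrimes.divisors, if l ∣ d then s.nu d * weight s R d else 0)
      = ∑ d ∈ s.prodPrimes.divisors with l ∣ d, ∑ m ∈ support s R with d ∣ m,
          (μ d : ℝ) * (s.selbergTerms m / mass s R) := by
        rw [← sum_filter]
        refine sum_congr rfl fun d hd => ?_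
        have hnu := nu_ne_zero (Nat.dvd_of_mem_divisors (mem_filter.1 hd).1)
        rw [weight, ← mul_sum, ← sum_div]
        field_simp
    _ = ∑ m ∈ support s R, ∑ d ∈ m.divisors with l ∣ d,
          (μ d : ℝ) * (s.selbergTerms m / mass s R) := by
        refine sum_comm' fun d m => ?_
        simp only [mem_filter, Nat.mem_divisors, mem_support]
        exact ⟨fun ⟨⟨_, hld⟩, ⟨hmP, hmR⟩, hdm⟩ =>
            ⟨⟨⟨hdm, ne_zero_of_dvd_ne_zero prodPrimes_ne_zero hmP⟩, hld⟩, hmP, hmR⟩,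
          fun ⟨⟨⟨hdm, _⟩, hld⟩, hmP, hmR⟩ =>
            ⟨⟨⟨hdm.trans hmP, prodPrimes_ne_zero⟩, hld⟩, ⟨hmP, hmR⟩, hdm⟩⟩
    _ = ∑ m ∈ support s R, if l = m then μ l * (s.selbergTerms m / mass s R) else 0 := by
        refine sum_congr rfl fun m hm => ?_
        rw [← sum_mul, ← Int.cast_sum, sum_moebius_divisors_filter_dvd
          (squarefree_of_dvd_prodPrimes (mem_support.1 hm).1), Int.cast_ite, Int.cast_zero,
          ite_mul, zero_mul]
    _ = _ := by
        simp only [sum_ite_eq, mem_support, hl, true_and]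

theorem mainSum_lambdaSquared_weight :
    s.mainSum (lambdaSquared (weight s R)) = (mass s R)⁻¹ := by
  have hterm : ∀ l ∈ s.prodPrimes.divisors, (s.selbergTerms l)⁻¹ *
      (∑ d ∈ s.prodPrimes.divisors, if l ∣ d then s.nu d * weight s R d else 0) ^ 2 =
      if l ≤ R then s.selbergTerms l / (mass s R * mass s R) else 0 := by
    intro l hl
    have hlP := Nat.dvd_of_mem_divisors hl
    have hg := (selbergTerms_pos hlP).ne'
    have hmu : (μ l : ℝ) ^ 2 = 1 := by
      exact_mod_cast moebius_sq_eq_one_of_squarefree (squarefree_of_dvd_prodPrimes hlP)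
    rw [sum_dvd_nu_mul_weight hlP]
    split_ifs
    · rw [mul_pow, hmu]
      field_simp
    · rw [zero_pow two_ne_zero, mul_zero]
  rw [mainSum_lambdaSquared_eq_sum_mul_sum_sq, sum_congr rfl hterm, ← sum_filter, ← sum_div]
  exact div_self_mul_self' _

theorem sum_abs_weight_mul_le (hnu : ∀ d, d ∣ s.prodPrimes → (s.nu d)⁻¹ ≤ d) :
    ∑ d ∈ s.prodPrimes.divisors, |weight s R d| * d ≤ (R : ℝ) ^ 3 := by
  have hcard : (#(support s R) : ℝ) ≤ R := by
    have hsub : support s R ⊆ Icc 1 R := fun d hd =>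
      mem_Icc.2 ⟨Nat.pos_of_mem_divisors (mem_filter.1 hd).1, (mem_filter.1 hd).2⟩
    exact_mod_cast (card_le_card hsub).trans_eq (Nat.card_Icc 1 R)
  calc ∑ d ∈ s.prodPrimes.divisors, |weight s R d| * d
      = ∑ d ∈ support s R, |weight s R d| * d := by
        refine (sum_filter_of_ne fun d _ hd => ?_).symm
        by_contra! hRd
        exact hd (by rw [weight_eq_zero_of_lt hRd, abs_zero, zero_mul])
    _ ≤ ∑ _d ∈ support s R, (R : ℝ) * R := by
        refine sum_le_sum fun d hd => ?_
        obtain ⟨hdP, hdR⟩ := mem_support.1 hd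
        have hdR' : (d : ℝ) ≤ R := Nat.cast_le.2 hdR
        gcongr
        exact (abs_weight_le hdP).trans ((hnu d hdP).trans hdR')
    _ ≤ R * (R * R) := by
        rw [sum_const, nsmul_eq_mul]
        gcongr
    _ = (R : ℝ) ^ 3 := by ring

theorem siftedSum_le (hR : R ≠ 0) (hnu : ∀ d, d ∣ s.prodPrimes → (s.nu d)⁻¹ ≤ d)
    (hrem : ∀ d, d ∣ s.prodPrimes → |s.rem d| ≤ d) :
    s.siftedSum ≤ s.totalMass / mass s R + (R : ℝ) ^ 6 := by
  calc s.siftedSum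
      ≤ s.totalMass * s.mainSum (lambdaSquared (weight s R)) +
          s.errSum (lambdaSquared (weight s R)) :=
        siftedSum_le_mainSum_errSum_of_upperMoebius _ (upperMoebius_lambdaSquared _ (weight_one hR))
    _ ≤ s.totalMass / mass s R + ((R : ℝ) ^ 3) ^ 2 := by
        rw [mainSum_lambdaSquared_weight, ← div_eq_mul_inv]
        gcongr
        exact (errSum_lambdaSquared_le_sq hrem).trans (by gcongr; exact sum_abs_weight_mul_le hnu)
    _ = _ := by ring

end Selberg

theorem sum_le_sum_of_injOn {ι κ M : Type*} [AddCommMonoid M] [PartialOrder M]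
    [IsOrderedAddMonoid M] {s : Finset ι} {t : Finset κ} {f : ι → M} {g : κ → M} (e : ι → κ)
    (hmaps : Set.MapsTo e s t) (hinj : Set.InjOn e s) (hfg : ∀ x ∈ s, f x ≤ g (e x))
    (hg : ∀ y ∈ t, 0 ≤ g y) : ∑ x ∈ s, f x ≤ ∑ y ∈ t, g y := by
  classical
  calc ∑ x ∈ s, f x ≤ ∑ x ∈ s, g (e x) := sum_le_sum hfg
    _ = ∑ y ∈ s.image e, g y := (sum_image hinj).symm
    _ ≤ ∑ y ∈ t, g y := sum_le_sum_of_subset_of_nonneg (image_subset_iff.2 hmaps)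
        fun y hy _ => hg y hy

theorem sum_one_div_sq_le_two (S : Finset ℕ) : ∑ m ∈ S, 1 / (m : ℝ) ^ 2 ≤ 2 := by
  have hpi : Real.pi ^ 2 / 6 ≤ 2 := by nlinarith [Real.pi_lt_d2, Real.pi_pos]
  exact (sum_le_hasSum S (fun _ _ => by positivity) hasSum_zeta_two).trans hpi

/-- A finite set of positive integers that contains all the divisors of its elements. Harmonic
sums over such a set can be compared with their squarefree or coprime parts. -/
def DivisorClosed (S : Finset ℕ) : Prop := 0 ∉ S ∧ ∀ n ∈ S, n.divisors ⊆ S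

namespace DivisorClosed

variable {S : Finset ℕ}

theorem pos (hS : DivisorClosed S) {n : ℕ} (hn : n ∈ S) : 0 < n :=
  Nat.pos_of_ne_zero fun h => hS.1 (h ▸ hn)

theorem mem_of_dvd (hS : DivisorClosed S) {d n : ℕ} (hn : n ∈ S) (hd : d ∣ n) : d ∈ S :=
  hS.2 n hn (Nat.mem_divisors.2 ⟨hd, (hS.pos hn).ne'⟩)

theorem filter_squarefree (hS : DivisorClosed S) : DivisorClosed {n ∈ S | Squarefree n} := by
  refine ⟨fun h => hS.1 (mem_filter.1 h).1, fun n hn d hd => ?_⟩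
  obtain ⟨hnS, hsq⟩ := mem_filter.1 hn
  have hdn := Nat.dvd_of_mem_divisors hd
  exact mem_filter.2 ⟨hS.mem_of_dvd hnS hdn, hsq.squarefree_of_dvd hdn⟩

theorem sum_one_div_le (hS : DivisorClosed S) :
    ∑ n ∈ S, 1 / (n : ℝ) ≤ 2 * ∑ a ∈ S with Squarefree a, 1 / (a : ℝ) := by
  choose a b hab ha using Nat.sq_mul_squarefree
  have han (n : ℕ) : a n ∣ n := Dvd.intro_left _ (hab n)
  have hbn (n : ℕ) : b n ∣ n := (dvd_pow_self _ two_ne_zero).trans (Dvd.intro _ (hab n))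
  calc ∑ n ∈ S, 1 / (n : ℝ)
      ≤ ∑ x ∈ S ×ˢ {n ∈ S | Squarefree n}, 1 / (x.1 : ℝ) ^ 2 * (1 / (x.2 : ℝ)) := by
        refine sum_le_sum_of_injOn (fun n => (b n, a n)) (fun n hn => ?_)
          (Set.LeftInvOn.injOn (f₁' := fun x => x.1 ^ 2 * x.2) fun n _ => hab n)
          (fun n _ => ?_) fun _ _ => by positivity
        · exact mem_product.2 ⟨hS.mem_of_dvd hn (hbn n),
            mem_filter.2 ⟨hS.mem_of_dvd hn (han n), ha n⟩⟩
        · conv_lhs => rw [← hab n]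
          rw [Nat.cast_mul, Nat.cast_pow, one_div_mul_one_div]
    _ = (∑ m ∈ S, 1 / (m : ℝ) ^ 2) * ∑ a ∈ S with Squarefree a, 1 / (a : ℝ) := by
        rw [sum_mul_sum, sum_product]
    _ ≤ _ := by
        gcongr
        exact sum_one_div_sq_le_two S

theorem sq_sum_one_div_le (hS : DivisorClosed S) :
    (∑ a ∈ S, 1 / (a : ℝ)) ^ 2 ≤
      2 * ∑ x ∈ S ×ˢ S with x.1.Coprime x.2, 1 / ((x.1 * x.2 : ℕ) : ℝ) := by
  calc (∑ a ∈ S, 1 / (a : ℝ)) ^ 2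
      = ∑ x ∈ S ×ˢ S, 1 / ((x.1 * x.2 : ℕ) : ℝ) := by
        simp only [sq, sum_mul_sum, sum_product, one_div_mul_one_div, Nat.cast_mul]
    _ ≤ ∑ y ∈ S ×ˢ {x ∈ S ×ˢ S | x.1.Coprime x.2},
          1 / (y.1 : ℝ) ^ 2 * (1 / ((y.2.1 * y.2.2 : ℕ) : ℝ)) := by
        refine sum_le_sum_of_injOn
          (fun x => (x.1.gcd x.2, x.1 / x.1.gcd x.2, x.2 / x.1.gcd x.2)) ?_
          (Set.LeftInvOn.injOn (f₁' := fun y => (y.2.1 * y.1, y.2.2 * y.1)) ?_) ?_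
          fun _ _ => by positivity
        · rintro ⟨a, b⟩ hx
          obtain ⟨ha, hb⟩ := mem_product.1 hx
          refine mem_product.2 ⟨hS.mem_of_dvd ha (Nat.gcd_dvd_left a b), mem_filter.2
            ⟨mem_product.2 ⟨hS.mem_of_dvd ha (Nat.div_dvd_of_dvd (Nat.gcd_dvd_left a b)),
              hS.mem_of_dvd hb (Nat.div_dvd_of_dvd (Nat.gcd_dvd_right a b))⟩,
              Nat.coprime_div_gcd_div_gcd (Nat.gcd_pos_of_pos_left b (hS.pos ha))⟩⟩
        · rintro ⟨a, b⟩ _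
          exact Prod.ext (Nat.div_mul_cancel (Nat.gcd_dvd_left a b))
            (Nat.div_mul_cancel (Nat.gcd_dvd_right a b))
        · rintro ⟨a, b⟩ _
          have hfactor : a * b = a.gcd b ^ 2 * (a / a.gcd b * (b / a.gcd b)) := by
            have ha := Nat.div_mul_cancel (Nat.gcd_dvd_left a b)
            have hb := Nat.div_mul_cancel (Nat.gcd_dvd_right a b)
            calc a * b = a / a.gcd b * a.gcd b * (b / a.gcd b * a.gcd b) := by rw [ha, hb]
              _ = _ := by ring
          dsimp only
          rw [one_div_mul_one_div, ← Nat.cast_pow, ← Nat.cast_mul, ← hfactor]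
    _ = (∑ m ∈ S, 1 / (m : ℝ) ^ 2) *
          ∑ x ∈ S ×ˢ S with x.1.Coprime x.2, 1 / ((x.1 * x.2 : ℕ) : ℝ) := by
        rw [sum_mul_sum, sum_product]
    _ ≤ _ := by
        gcongr
        exact sum_one_div_sq_le_two S

end DivisorClosed

namespace PrimePairs

theorem divisorClosed_filter_coprime (q Y : ℕ) : DivisorClosed {n ∈ Icc 1 Y | n.Coprime q} := by
  refine ⟨fun h => absurd (mem_Icc.1 (mem_filter.1 h).1).1 (by norm_num), fun n hn d hd => ?_⟩
  obtain ⟨hnY, hnq⟩ := mem_filter.1 hn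
  exact mem_filter.2 ⟨mem_Icc.2 ⟨Nat.pos_of_mem_divisors hd,
    (Nat.divisor_le hd).trans (mem_Icc.1 hnY).2⟩, hnq.coprime_dvd_left (Nat.dvd_of_mem_divisors hd)⟩

/-- The squarefree integers in `[1, Y]` that are coprime to `q`, over which the mass of the sieve
for prime pairs is bounded from below. -/
def squarefreeCoprime (q Y : ℕ) : Finset ℕ := {n ∈ {n ∈ Icc 1 Y | n.Coprime q} | Squarefree n}

theorem mem_squarefreeCoprime {q Y n : ℕ} :
    n ∈ squarefreeCoprime q Y ↔ n ≤ Y ∧ n.Coprime q ∧ Squarefree n := by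
  simp only [squarefreeCoprime, mem_filter, mem_Icc, and_assoc]
  exact ⟨And.right, fun h => ⟨Nat.one_le_iff_ne_zero.2 h.2.2.ne_zero, h⟩⟩

theorem log_le_mul_sum_coprime {q : ℕ} (hq : q ≠ 0) (K : ℕ) :
    Real.log K ≤ q * ∑ n ∈ Icc 1 (q * K) with n.Coprime q, 1 / (n : ℝ) := by
  have hq1 : 1 ≤ q := Nat.one_le_iff_ne_zero.2 hq
  calc Real.log K ≤ (harmonic K : ℝ) := by
        simpa only [Nat.floor_natCast] using log_le_harmonic_floor K K.cast_nonneg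
    _ = ∑ k ∈ range K, 1 / ((k : ℝ) + 1) := by
        rw [harmonic]
        push_cast
        simp only [one_div]
    _ ≤ ∑ n ∈ Icc 1 (q * K) with n.Coprime q, q * (1 / (n : ℝ)) := by
        refine sum_le_sum_of_injOn (fun k => q * k + 1) (fun k hk => ?_) (fun k _ l _ hkl => ?_)
          (fun k _ => ?_) fun _ _ => by positivity
        · have hkK : q * (k + 1) ≤ q * K := Nat.mul_le_mul_left q (mem_range.1 hk)
          exact mem_filter.2 ⟨mem_Icc.2 ⟨Nat.le_add_left 1 _, by linarith⟩, by simp⟩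
        · exact Nat.eq_of_mul_eq_mul_left hq1 (Nat.succ_injective hkl)
        · have hq1' : (1 : ℝ) ≤ q := Nat.one_le_cast.2 hq1
          rw [mul_one_div, div_le_div_iff₀ (by positivity) (by positivity)]
          push_cast
          linarith
    _ = _ := (mul_sum _ _ _).symm

theorem sum_coprime_pairs_le_sum_card_divisors_div (q Y : ℕ) :
    ∑ x ∈ squarefreeCoprime q Y ×ˢ squarefreeCoprime q Y with x.1.Coprime x.2,
        1 / ((x.1 * x.2 : ℕ) : ℝ) ≤
      ∑ l ∈ squarefreeCoprime q (Y ^ 2), (#l.divisors : ℝ) / l := by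
  have hmaps : ∀ x ∈ {x ∈ squarefreeCoprime q Y ×ˢ squarefreeCoprime q Y | x.1.Coprime x.2},
      x.1 * x.2 ∈ squarefreeCoprime q (Y ^ 2) := by
    rintro ⟨a, b⟩ hx
    simp only [mem_filter, mem_product, mem_squarefreeCoprime] at hx ⊢
    obtain ⟨⟨⟨haY, haq, ha⟩, hbY, hbq, hb⟩, hab⟩ := hx
    exact ⟨sq Y ▸ Nat.mul_le_mul haY hbY, haq.mul_left hbq, (Nat.squarefree_mul hab).2 ⟨ha, hb⟩⟩
  rw [← sum_fiberwise_of_maps_to hmaps]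
  refine sum_le_sum fun l hl => ?_
  have hl0 : l ≠ 0 := (mem_squarefreeCoprime.1 hl).2.2.ne_zero
  calc _ ≤ ∑ x ∈ l.divisorsAntidiagonal, 1 / ((x.1 * x.2 : ℕ) : ℝ) :=
        sum_le_sum_of_subset_of_nonneg
          (fun x hx => Nat.mem_divisorsAntidiagonal.2 ⟨(mem_filter.1 hx).2, hl0⟩)
          fun _ _ _ => by positivity
    _ = ∑ _x ∈ l.divisorsAntidiagonal, 1 / (l : ℝ) :=
        sum_congr rfl fun x hx => by rw [(Nat.mem_divisorsAntidiagonal.1 hx).1]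
    _ = (#l.divisors : ℝ) / l := by
        rw [sum_const, nsmul_eq_mul, mul_one_div, ← Nat.map_div_right_divisors, card_map]

theorem log_sq_le_mul_sum_card_divisors_div {q : ℕ} (hq : q ≠ 0) (K : ℕ) :
    Real.log K ^ 2 ≤
      8 * q ^ 2 * ∑ l ∈ squarefreeCoprime q ((q * K) ^ 2), (#l.divisors : ℝ) / l := by
  have hclosed := divisorClosed_filter_coprime q (q * K)
  calc Real.log K ^ 2
      ≤ (q * (2 * ∑ a ∈ squarefreeCoprime q (q * K), 1 / (a : ℝ))) ^ 2 := by
        gcongr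
        exact (log_le_mul_sum_coprime hq K).trans (by gcongr; exact hclosed.sum_one_div_le)
    _ = 4 * q ^ 2 * (∑ a ∈ squarefreeCoprime q (q * K), 1 / (a : ℝ)) ^ 2 := by ring
    _ ≤ 4 * q ^ 2 * (2 * ∑ l ∈ squarefreeCoprime q ((q * K) ^ 2), (#l.divisors : ℝ) / l) := by
        gcongr
        exact hclosed.filter_squarefree.sq_sum_one_div_le.trans
          (by gcongr; exact sum_coprime_pairs_le_sum_card_divisors_div q (q * K))
    _ = _ := by ring

end PrimePairs

namespace PrimePairs

theorem abs_card_filter_modEq_sub_le {d : ℕ} (hd : 0 < d) (N c : ℕ) :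
    |(#{n ∈ range N | n ≡ c [MOD d]} : ℝ) - N / d| ≤ 1 := by
  have hcount : (#{n ∈ range N | n ≡ c [MOD d]} : ℤ) = ⌈((N : ℝ) - (c % d : ℕ)) / d⌉ := by
    rw [← Nat.count_eq_card_filter_range, Nat.count_modEq_card_eq_ceil N hd c,
      ← Rat.ceil_cast (α := ℝ)]
    push_cast
    rfl
  have hcount' : (#{n ∈ range N | n ≡ c [MOD d]} : ℝ) = ⌈((N : ℝ) - (c % d : ℕ)) / d⌉ := by
    exact_mod_cast hcount
  have hd' : (0 : ℝ) < d := Nat.cast_pos.2 hd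
  have hmod : ((c % d : ℕ) : ℝ) / d ≤ 1 :=
    (div_le_one hd').2 (Nat.cast_le.2 (Nat.mod_lt c hd).le)
  have hmod0 : (0 : ℝ) ≤ ((c % d : ℕ) : ℝ) / d := by positivity
  have hle := Int.le_ceil (((N : ℝ) - (c % d : ℕ)) / d)
  have hlt := Int.ceil_lt_add_one (((N : ℝ) - (c % d : ℕ)) / d)
  rw [sub_div] at hle hlt
  rw [hcount', sub_div, abs_le]
  constructor <;> linarith

theorem coprime_of_dvd_add {b h n : ℕ} (hbh : b.Coprime h) (hb : b ∣ n + h) : b.Coprime n := by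
  refine Nat.Coprime.eq_one_of_dvd (hbh.coprime_dvd_left (Nat.gcd_dvd_left b n)) ?_
  exact (Nat.dvd_add_right (Nat.gcd_dvd_right b n)).1 ((Nat.gcd_dvd_left b n).trans hb)

theorem dvd_mul_add_and_gcd_eq_iff {a b h n : ℕ} (ha : a ≠ 0) (hab : a.Coprime b)
    (hbh : b.Coprime h) :
    a * b ∣ n * (n + h) ∧ (a * b).gcd n = a ↔ a ∣ n ∧ b ∣ n + h := by
  constructor
  · rintro ⟨hdvd, hgcd⟩
    have han : a ∣ n := hgcd ▸ Nat.gcd_dvd_right (a * b) n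
    refine ⟨han, ?_⟩
    obtain ⟨m, rfl⟩ := han
    have hbm : b.Coprime m := by
      rwa [Nat.gcd_mul_left, Nat.mul_eq_left ha] at hgcd
    exact (hab.symm.mul_right hbm).dvd_of_dvd_mul_left ((Nat.dvd_mul_left b a).trans hdvd)
  · rintro ⟨han, hbn⟩
    refine ⟨Nat.mul_dvd_mul han hbn, ?_⟩
    rw [(coprime_of_dvd_add hbh hbn).gcd_mul_right_cancel, Nat.gcd_eq_left han]

theorem exists_dvd_and_dvd_add_iff_modEq {a b : ℕ} (hab : a.Coprime b) (hb : b ≠ 0) (h : ℕ) :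
    ∃ c, ∀ n, a ∣ n ∧ b ∣ n + h ↔ n ≡ c [MOD a * b] := by
  obtain ⟨c, hca, hcb⟩ := Nat.chineseRemainder hab 0 (h * (b - 1))
  have hcb' : b ∣ c + h := by
    have : h * (b - 1) + h = h * b := by
      rw [← mul_add_one, Nat.sub_add_cancel (Nat.one_le_iff_ne_zero.2 hb)]
    have hmod : c + h ≡ h * b [MOD b] := this ▸ hcb.add_right h
    exact (hmod.dvd_iff dvd_rfl).2 (Nat.dvd_mul_left b h)
  refine ⟨c, fun n => ?_⟩
  rw [← Nat.modEq_and_modEq_iff_modEq_mul hab]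
  refine and_congr ?_ ?_
  · rw [← Nat.modEq_zero_iff_dvd]
    exact ⟨fun hn => hn.trans hca.symm, fun hn => hn.trans hca⟩
  · have hc0 := Nat.modEq_zero_iff_dvd.2 hcb'
    rw [← Nat.modEq_zero_iff_dvd]
    exact ⟨fun hn => (hn.trans hc0.symm).add_right_cancel' h,
      fun hn => (hn.add_right h).trans hc0⟩

theorem abs_card_dvd_mul_add_sub_le {d h : ℕ} (hd : Squarefree d) (hdh : d.Coprime h) (N : ℕ) :
    |(#{n ∈ range N | d ∣ n * (n + h)} : ℝ) - (#d.divisors : ℝ) / d * N| ≤ d := by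
  have hmaps : ∀ n ∈ {n ∈ range N | d ∣ n * (n + h)}, d.gcd n ∈ d.divisors := fun n _ =>
    Nat.mem_divisors.2 ⟨Nat.gcd_dvd_left d n, hd.ne_zero⟩
  have hfiber : ∀ a ∈ d.divisors,
      |(#{n ∈ {n ∈ range N | d ∣ n * (n + h)} | d.gcd n = a} : ℝ) - N / d| ≤ 1 := by
    intro a ha
    obtain ⟨b, rfl⟩ := Nat.dvd_of_mem_divisors ha
    have hab := Nat.coprime_of_squarefree_mul hd
    have ha0 : a ≠ 0 := left_ne_zero_of_mul hd.ne_zero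
    have hb0 : b ≠ 0 := right_ne_zero_of_mul hd.ne_zero
    have hbh : b.Coprime h := Nat.Coprime.coprime_mul_left hdh
    obtain ⟨c, hc⟩ := exists_dvd_and_dvd_add_iff_modEq hab hb0 h
    rw [filter_filter, filter_congr fun n _ =>
      (dvd_mul_add_and_gcd_eq_iff ha0 hab hbh).trans (hc n)]
    exact abs_card_filter_modEq_sub_le (Nat.pos_of_ne_zero hd.ne_zero) N c
  calc |(#{n ∈ range N | d ∣ n * (n + h)} : ℝ) - (#d.divisors : ℝ) / d * N|
      = |∑ a ∈ d.divisors,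
          ((#{n ∈ {n ∈ range N | d ∣ n * (n + h)} | d.gcd n = a} : ℝ) - N / d)| := by
        rw [card_eq_sum_card_fiberwise hmaps, sum_sub_distrib, sum_const, nsmul_eq_mul,
          Nat.cast_sum, div_mul_eq_mul_div, mul_div_assoc]
    _ ≤ ∑ _a ∈ d.divisors, (1 : ℝ) := (abs_sum_le_sum_abs _ _).trans (sum_le_sum hfiber)
    _ = #d.divisors := by rw [sum_const, nsmul_one]
    _ ≤ d := Nat.cast_le.2 (Nat.card_divisors_le_self d)

/-- The density `τ(d) / d` of the integers `n` with `d ∣ n (n + h)`, for squarefree `d` coprime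
to `h`. -/
noncomputable def pairDensity : ArithmeticFunction ℝ :=
  ((sigma 0 : ArithmeticFunction ℕ) : ArithmeticFunction ℝ).pdiv
    ((ArithmeticFunction.id : ArithmeticFunction ℕ) : ArithmeticFunction ℝ)

theorem pairDensity_apply (d : ℕ) : pairDensity d = (#d.divisors : ℝ) / d := by
  simp [pairDensity, sigma_zero_apply]

theorem strictMono_mul_add (h : ℕ) : StrictMono fun n : ℕ => n * (n + h) := fun _ _ hmn =>
  Nat.mul_lt_mul'' hmn (Nat.add_lt_add_right hmn h)

/-- The product of the primes up to `R` that do not divide `q`. -/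
def coprimePrimorial (q R : ℕ) : ℕ := primorial R / (primorial R).gcd q

section coprimePrimorial

variable {q R : ℕ}

theorem coprimePrimorial_dvd_primorial : coprimePrimorial q R ∣ primorial R :=
  Nat.div_dvd_of_dvd (Nat.gcd_dvd_left _ _)

theorem squarefree_coprimePrimorial : Squarefree (coprimePrimorial q R) :=
  (squarefree_primorial R).squarefree_of_dvd coprimePrimorial_dvd_primorial

theorem coprime_coprimePrimorial (hq : q ≠ 0) : (coprimePrimorial q R).Coprime q :=
  Nat.coprime_div_gcd_of_squarefree (squarefree_primorial R) hq

theorem dvd_coprimePrimorial {l : ℕ} (hl : l ∈ squarefreeCoprime q R) :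
    l ∣ coprimePrimorial q R := by
  obtain ⟨hlR, hlq, hlsq⟩ := mem_squarefreeCoprime.1 hl
  have hlP : l ∣ primorial R := hlsq.dvd_primorial.trans (primorial_dvd_primorial hlR)
  have hPl : coprimePrimorial q R * (primorial R).gcd q = primorial R :=
    Nat.div_mul_cancel (Nat.gcd_dvd_left _ _)
  exact (hlq.coprime_dvd_right (Nat.gcd_dvd_right _ _)).dvd_of_dvd_mul_right (hPl ▸ hlP)

theorem coprimePrimorial_coprime_of_lt {p : ℕ} (hp : p.Prime) (hR : R < p) :
    (coprimePrimorial q R).Coprime p := by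
  refine Nat.Coprime.coprime_dvd_left coprimePrimorial_dvd_primorial
    (Nat.coprime_comm.1 (hp.coprime_iff_not_dvd.2 fun hd => ?_))
  exact hR.not_ge (hp.dvd_primorial_iff.1 hd)

end coprimePrimorial

/-- The sieve of the integers `n (n + h)`, `n < N`, by the primes up to `R` that do not divide
`2 h`. The prime `2` is left out because its density for odd `h` would be `1`. -/
noncomputable def pairSieve {h : ℕ} (hh : h ≠ 0) (N R : ℕ) : BoundingSieve where
  support := (range N).image fun n => n * (n + h)
  prodPrimes := coprimePrimorial (2 * h) R
  prodPrimes_squarefree := squarefree_coprimePrimorial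
  weights _ := 1
  weights_nonneg _ := zero_le_one
  totalMass := N
  nu := pairDensity
  nu_mult := isMultiplicative_sigma.natCast.pdiv isMultiplicative_id.natCast
  nu_pos_of_prime p hp _ := by
    rw [pairDensity_apply]
    have := hp.pos
    have := card_pos.2 (Nat.nonempty_divisors.2 hp.ne_zero)
    positivity
  nu_lt_one_of_prime p hp hpP := by
    have hp2 : p ≠ 2 := by
      intro hp2
      have hcop := coprime_coprimePrimorial (R := R) (mul_ne_zero two_ne_zero hh)
      exact Nat.not_coprime_of_dvd_of_dvd hp.one_lt hpP (hp2 ▸ Nat.dvd_mul_right 2 h) hcop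
    have hp3 : 2 < p := hp.two_le.lt_of_ne' hp2
    rw [pairDensity_apply, hp.divisors, card_pair hp.one_lt.ne,
      div_lt_one (Nat.cast_pos.2 hp.pos)]
    exact Nat.cast_lt.2 hp3

section pairSieve

variable {h : ℕ} (hh : h ≠ 0) (N R : ℕ)

theorem abs_rem_pairSieve_le {d : ℕ} (hd : d ∣ (pairSieve hh N R).prodPrimes) :
    |(pairSieve hh N R).rem d| ≤ d := by
  have hdh : d.Coprime h := (Nat.Coprime.coprime_dvd_left hd
    (coprime_coprimePrimorial (mul_ne_zero two_ne_zero hh))).coprime_mul_left_right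
  convert abs_card_dvd_mul_add_sub_le (squarefree_coprimePrimorial.squarefree_of_dvd hd) hdh N
    using 2
  simp only [BoundingSieve.rem, BoundingSieve.multSum, pairSieve, pairDensity_apply]
  rw [sum_image (strictMono_mul_add h).injective.injOn, ← sum_filter, sum_const, nsmul_one]

theorem inv_nu_pairSieve_le {d : ℕ} (hd : d ∣ (pairSieve hh N R).prodPrimes) :
    ((pairSieve hh N R).nu d)⁻¹ ≤ d := by
  have hd0 : d ≠ 0 := ne_zero_of_dvd_ne_zero squarefree_coprimePrimorial.ne_zero hd
  have hcard : (1 : ℝ) ≤ #d.divisors := Nat.one_le_cast.2 (card_pos.2 (Nat.nonempty_divisors.2 hd0))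
  change (pairDensity d)⁻¹ ≤ d
  rw [pairDensity_apply, inv_div]
  exact div_le_self (Nat.cast_nonneg _) hcard

theorem sum_card_divisors_div_le_mass_pairSieve :
    ∑ l ∈ squarefreeCoprime (2 * h) R, (#l.divisors : ℝ) / l ≤
      Selberg.mass (pairSieve hh N R) R := by
  have hsub : squarefreeCoprime (2 * h) R ⊆ Selberg.support (pairSieve hh N R) R := fun l hl =>
    Selberg.mem_support.2 ⟨dvd_coprimePrimorial hl, (mem_squarefreeCoprime.1 hl).1⟩
  calc ∑ l ∈ squarefreeCoprime (2 * h) R, (#l.divisors : ℝ) / l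
      ≤ ∑ l ∈ squarefreeCoprime (2 * h) R, (pairSieve hh N R).selbergTerms l := by
        refine sum_le_sum fun l hl => ?_
        rw [← pairDensity_apply]
        exact Selberg.nu_le_selbergTerms (s := pairSieve hh N R) (dvd_coprimePrimorial hl)
    _ ≤ Selberg.mass (pairSieve hh N R) R :=
        sum_le_sum_of_subset_of_nonneg hsub fun l hl _ => Selberg.selbergTerms_nonneg hl

theorem card_primePairs_gt_le_siftedSum :
    (#{v ∈ range N | R < v ∧ v.Prime ∧ (v + h).Prime} : ℝ) ≤ (pairSieve hh N R).siftedSum := by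
  change _ ≤ ∑ n ∈ (range N).image fun n => n * (n + h),
    if (coprimePrimorial (2 * h) R).Coprime n then (1 : ℝ) else 0
  rw [sum_image (strictMono_mul_add h).injective.injOn, ← sum_filter, sum_const, nsmul_one]
  refine Nat.cast_le.2 (card_le_card fun v hv => ?_)
  obtain ⟨hvN, hRv, hv, hvh⟩ := mem_filter.1 hv
  exact mem_filter.2 ⟨hvN, (coprimePrimorial_coprime_of_lt hv hRv).mul_right
    (coprimePrimorial_coprime_of_lt hvh (Nat.lt_add_right h hRv))⟩

theorem log_sq_le_mul_mass_pairSieve (K : ℕ) :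
    Real.log K ^ 2 ≤ 32 * h ^ 2 *
      Selberg.mass (pairSieve hh N ((2 * h * K) ^ 2)) ((2 * h * K) ^ 2) := by
  refine (log_sq_le_mul_sum_card_divisors_div (mul_ne_zero two_ne_zero hh) K).trans ?_
  calc _ ≤ 8 * ((2 * h : ℕ) : ℝ) ^ 2 *
        Selberg.mass (pairSieve hh N ((2 * h * K) ^ 2)) ((2 * h * K) ^ 2) := by
        gcongr
        exact sum_card_divisors_div_le_mass_pairSieve hh N _
    _ = _ := by push_cast; ring

end pairSieve

theorem card_primePairs_gt_le {h K : ℕ} (hh : h ≠ 0) (hK : 1 < K) (N : ℕ) :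
    (#{v ∈ range N | (2 * h * K) ^ 2 < v ∧ v.Prime ∧ (v + h).Prime} : ℝ) ≤
      32 * h ^ 2 * N / Real.log K ^ 2 + (2 * h * K) ^ 12 := by
  set R := (2 * h * K) ^ 2 with hRdef
  have hR : R ≠ 0 := by positivity
  have hlog : 0 < Real.log K := Real.log_pos (Nat.one_lt_cast.2 hK)
  have hmass := Selberg.mass_pos (s := pairSieve hh N R) hR
  calc _ ≤ (pairSieve hh N R).siftedSum := card_primePairs_gt_le_siftedSum hh N R
    _ ≤ N / Selberg.mass (pairSieve hh N R) R + (R : ℝ) ^ 6 :=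
        Selberg.siftedSum_le hR (fun d => inv_nu_pairSieve_le hh N R)
          fun d => abs_rem_pairSieve_le hh N R
    _ ≤ 32 * h ^ 2 * N / Real.log K ^ 2 + (2 * h * K) ^ 12 := by
        gcongr ?_ + ?_
        · rw [div_le_div_iff₀ hmass (by positivity)]
          calc N * Real.log K ^ 2 ≤ N * (32 * h ^ 2 * Selberg.mass (pairSieve hh N R) R) := by
                gcongr
                exact log_sq_le_mul_mass_pairSieve hh N K
            _ = _ := by ring
        · rw [hRdef]
          push_cast
          exact le_of_eq (by ring)

theorem card_primePairs_le {h K : ℕ} (hh : h ≠ 0) (hK : 1 < K) (N : ℕ) :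
    (#{v ∈ range N | v.Prime ∧ (v + h).Prime} : ℝ) ≤
      32 * h ^ 2 * N / Real.log K ^ 2 + 2 * (2 * h * K) ^ 12 := by
  set R := (2 * h * K) ^ 2
  have hsplit : {v ∈ range N | v.Prime ∧ (v + h).Prime} ⊆
      {v ∈ range N | R < v ∧ v.Prime ∧ (v + h).Prime} ∪ Icc 1 R := by
    intro v hv
    obtain ⟨hvN, hpair⟩ := mem_filter.1 hv
    rcases lt_or_ge R v with hRv | hvR
    · exact mem_union_left _ (mem_filter.2 ⟨hvN, hRv, hpair⟩)
    · exact mem_union_right _ (mem_Icc.2 ⟨hpair.1.pos, hvR⟩)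
  have hcard : #{v ∈ range N | v.Prime ∧ (v + h).Prime} ≤
      #{v ∈ range N | R < v ∧ v.Prime ∧ (v + h).Prime} + R := by
    simpa only [Nat.card_Icc, Nat.add_sub_cancel] using
      (card_le_card hsplit).trans (card_union_le _ _)
  have hR : (R : ℝ) ≤ (2 * h * K) ^ 12 := by
    have : R ≤ (2 * h * K) ^ 12 := Nat.pow_le_pow_right (by positivity) (by norm_num)
    exact_mod_cast this
  have hgt := card_primePairs_gt_le hh hK N
  have hcard' : (#{v ∈ range N | v.Prime ∧ (v + h).Prime} : ℝ) ≤
      #{v ∈ range N | R < v ∧ v.Prime ∧ (v + h).Prime} + R := by exact_mod_cast hcard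
  linarith

end PrimePairs

theorem sum_Ico_one_div_le {p : ℕ → Prop} [DecidablePred p] {M N : ℕ} (hM : 0 < M) {b : ℝ}
    (hcard : #{v ∈ range N | p v} ≤ b * M) : ∑ v ∈ Ico M N with p v, 1 / (v : ℝ) ≤ b := by
  have hM' : (0 : ℝ) < M := Nat.cast_pos.2 hM
  have hsub : {v ∈ Ico M N | p v} ⊆ {v ∈ range N | p v} :=
    filter_subset_filter p fun v hv => mem_range.2 (mem_Ico.1 hv).2
  have hterm : ∀ v ∈ {v ∈ Ico M N | p v}, 1 / (v : ℝ) ≤ 1 / M := fun v hv =>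
    one_div_le_one_div_of_le hM' (Nat.cast_le.2 (mem_Ico.1 (mem_filter.1 hv).1).1)
  calc ∑ v ∈ Ico M N with p v, 1 / (v : ℝ)
      ≤ #{v ∈ Ico M N | p v} * (1 / M : ℝ) := by
        simpa only [nsmul_eq_mul] using sum_le_card_nsmul _ _ _ hterm
    _ ≤ b * M * (1 / M) := by
        gcongr
        exact (Nat.cast_le.2 (card_le_card hsub)).trans hcard
    _ = b := by rw [mul_one_div, mul_div_cancel_right₀ b hM'.ne']

theorem summable_one_div_of_card_le {p : ℕ → Prop} [DecidablePred p] {a : ℕ} (ha : 1 < a)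
    {b : ℕ → ℝ} (hb : Summable b)
    (hcard : ∀ m, #{v ∈ range (a ^ (m + 1)) | p v} ≤ b m * (a ^ m : ℕ)) :
    Summable fun v : {v | p v} => 1 / (v : ℝ) := by
  have hpos (m : ℕ) : 0 < a ^ m := by positivity
  have hblock (m : ℕ) : ∑ v ∈ Ico (a ^ m) (a ^ (m + 1)) with p v, 1 / (v : ℝ) ≤ b m :=
    sum_Ico_one_div_le (hpos m) (hcard m)
  have hb0 (m : ℕ) : 0 ≤ b m := (sum_nonneg fun _ _ => by positivity).trans (hblock m)
  have hpow (M : ℕ) : ∑ v ∈ range (a ^ M) with p v, 1 / (v : ℝ) ≤ ∑ m ∈ range M, b m := by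
    induction M with
    | zero => simp [sum_filter]
    | succ M ih =>
      rw [sum_filter, ← sum_range_add_sum_Ico _ (Nat.pow_le_pow_right ha.le M.le_succ),
        ← sum_filter, ← sum_filter, sum_range_succ]
      exact add_le_add ih (hblock M)
  refine (summable_subtype_iff_indicator (f := fun v : ℕ => 1 / (v : ℝ))).2
    (summable_of_sum_range_le (c := ∑' m, b m)
      (Set.indicator_nonneg fun v _ => by positivity) fun N => ?_)
  calc ∑ v ∈ range N, {v | p v}.indicator (fun v : ℕ => 1 / (v : ℝ)) v
      = ∑ v ∈ range N with p v, 1 / (v : ℝ) := by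
        simp only [Set.indicator_apply, Set.mem_ofPred_eq, sum_filter]
    _ ≤ ∑ v ∈ range (a ^ N) with p v, 1 / (v : ℝ) :=
        sum_le_sum_of_subset_of_nonneg
          (filter_subset_filter p (range_subset_range.2 (Nat.lt_pow_self ha).le))
          fun _ _ _ => by positivity
    _ ≤ ∑ m ∈ range N, b m := hpow N
    _ ≤ ∑' m, b m := hb.sum_le_tsum _ fun m _ => hb0 m

namespace PrimePairs

theorem card_primePairs_pow_le {h : ℕ} (hh : h ≠ 0) (m : ℕ) :
    (#{v ∈ range ((2 ^ 13) ^ (m + 1)) | v.Prime ∧ (v + h).Prime} : ℝ) ≤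
      (32 * h ^ 2 * 2 ^ 13 / Real.log 2 ^ 2 * (1 / (m + 1 : ℕ) ^ 2) +
        2 * (4 * h) ^ 12 * (1 / 2) ^ m) * ((2 ^ 13) ^ m : ℕ) := by
  have hlog : Real.log 2 ≠ 0 := (Real.log_pos one_lt_two).ne'
  have hpow : ((2 : ℝ) ^ m) ^ 12 = (1 / 2) ^ m * (2 ^ 13) ^ m := by
    rw [pow_right_comm, ← mul_pow]
    norm_num
  -- The ratio `2 ^ 13` of the ranges beats the remainder `K ^ 12` for `K = 2 ^ (m + 1)`.
  refine (card_primePairs_le hh (K := 2 ^ (m + 1)) (Nat.one_lt_two_pow m.succ_ne_zero) _).trans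
    (le_of_eq ?_)
  simp only [Nat.cast_pow, Nat.cast_ofNat]
  rw [Real.log_pow, add_mul]
  congr 1
  · rw [pow_succ (2 ^ 13 : ℝ) m]
    field_simp
  · calc 2 * (2 * h * (2 : ℝ) ^ (m + 1)) ^ 12 = 2 * (4 * h) ^ 12 * (2 ^ m) ^ 12 := by ring
      _ = _ := by rw [hpow, mul_assoc _ _ ((2 ^ 13) ^ m)]

theorem summable_one_div {h : ℕ} (hh : h ≠ 0) :
    Summable fun v : {v : ℕ | v.Prime ∧ (v + h).Prime} => 1 / (v : ℝ) := by
  have hsq : Summable fun m : ℕ => 1 / ((m + 1 : ℕ) : ℝ) ^ 2 :=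
    (summable_nat_add_iff 1).2 (Real.summable_one_div_nat_pow.2 one_lt_two)
  exact summable_one_div_of_card_le (by norm_num)
    ((hsq.mul_left _).add (summable_geometric_two.mul_left _)) (card_primePairs_pow_le hh)

end PrimePairs

theorem theorem4_general {h : ℕ} (hh : h ≠ 0) {T : Set ℕ}
    (hT : T ⊆ {v : ℕ | v.Prime ∧ (v + h).Prime}) :
    Summable fun v : T => 1 / (v : ℝ) + 1 / ((v : ℝ) + h) := by
  have hsum : Summable fun v : T => 1 / (v : ℝ) := by
    simpa only [Function.comp_def, Set.coe_inclusion] using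
      (PrimePairs.summable_one_div hh).comp_injective (Set.inclusion_injective hT)
  refine hsum.add (hsum.of_nonneg_of_le (fun v => by positivity) fun v => ?_)
  have hv : (0 : ℝ) < (v : ℕ) := Nat.cast_pos.2 (hT v.2).1.pos
  exact one_div_le_one_div_of_le hv (le_add_of_nonneg_right h.cast_nonneg)

theorem theorem4 :
    Summable (fun v : TwinPairs.twins => (1 / (v : ℝ) + 1 / ((v : ℝ) + 2))) ∧
    Summable (fun v : TwinPairs.twinsU => (1 / (v : ℝ) + 1 / ((v : ℝ) + 2))) ∧
    Summable (fun v : TwinPairs.twinsB => (1 / (v : ℝ) + 1 / ((v : ℝ) + 2))) ∧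
    Summable (fun v : TwinPairs.strongTwins => (1 / (v : ℝ) + 1 / ((v : ℝ) + 2))) ∧
    Summable (fun v : TwinPairs.strongTwinsU => (1 / (v : ℝ) + 1 / ((v : ℝ) + 2))) ∧
    Summable (fun v : TwinPairs.strongTwinsB => (1 / (v : ℝ) + 1 / ((v : ℝ) + 2))) := by
  have key : ∀ T ⊆ TwinPairs.twins, Summable fun v : T => 1 / (v : ℝ) + 1 / ((v : ℝ) + 2) :=
    fun _ hT => mod_cast theorem4_general two_ne_zero fun v hv => (hT hv).2
  exact ⟨key _ subset_rfl, key _ fun _ h => h.1, key _ Set.sdiff_subset, key _ fun _ h => h.1,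
    key _ fun _ h => h.1.1, key _ fun _ h => h.1.1⟩
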